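/- Let $V$ be a finite-dimensional real vector space and let $M\subset V$ be a lattice (a discrete subgroup spanning $V$, so that $V=M\otimes_{\mathbb Z}\mathbb R$). Let $\mathbb C[M]$ be the group algebra of $M$, with basis elements $\mathbf e(m)$, $m\in M$, satisfying $\mathbf e(m)\mathbf e(m')=\mathbf e(m+m')$, and let $\mathbb C(M)$ be its field of fractions. For a finite set $S\subset M$ put $\chi_S=\sum_{m\in S}\mathbf e(m)\in\mathbb C[M]$. Let $C\subset V$ be a simplicial cone (the set of non-negative combinations of finitely many linearly independent vectors) generated by elements of $M$, and let $\lambda_1,\dots,\lambda_k$ be its primitive generators in $M$, i.e. the nonzero elements of $C\cap M$ which span the extremal rays of $C$ and are not proper integer multiples of elements of $M$. Put $Q_C=\{\sum_i a_i\lambda_i : 0\le a_i<1\}$ and define $$\nu^M_C=\sum_{c\in Q_C\cap M}\mathbf e(c)\ \prod_{i=1}^k\bigl(1-\mathbf e(\lambda_i)\bigr)^{-1}\in\mathbb C(M),\qquad \nu^M_{\alpha+C}=\mathbf e(\alpha)\,\nu^M_C\quad(\alpha\in M).$$ Let $\Box\subset V$ be a simple convex lattice polytope: a bounded intersection of finitely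 many closed affine half-spaces (not necessarily of full dimension) whose set of extreme points $\mathrm{ext}\,\Box$ is contained in $M$, and such that for every $\alpha\in\mathrm{ext}\,\Box$ the tangent cone $C_\alpha=\{r(v-\alpha): r\ge 0,\ v\in\Box\}$ is simplicial. Then, in $\mathbb C(M)$, $$\chi_{\Box\cap M}=\sum_{\alpha\in\mathrm{ext}\,\Box}\nu^M_{\alpha+C_\alpha}=\sum_{\alpha\in\mathrm{ext}\,\Box}\mathbf e(\alpha)\,\nu^M_{C_\alpha}.$$ -/

import Mathlib

noncomputable section

namespace Brion

open AddMonoidAlgebra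

section Convex

variable {V : Type*} [NormedAddCommGroup V] [NormedSpace ℝ V]

/-- A convex polytope: a bounded intersection of finitely many closed affine half-spaces
`{x | φ x ≤ b}` with `φ ≠ 0`. It need not have full dimension. -/
def IsConvexPolytope (P : Set V) : Prop :=
  Bornology.IsBounded P ∧
    ∃ H : Finset (Module.Dual ℝ V × ℝ),
      (∀ h ∈ H, h.1 ≠ 0) ∧ P = {x | ∀ h ∈ H, h.1 x ≤ h.2}

/-- The tangent cone `ℝ≥0 (P - α)` of `P` at `α`; its apex is the origin. -/
def tangentCone (P : Set V) (α : V) : Set V :=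
  {w | ∃ r : ℝ, 0 ≤ r ∧ ∃ v ∈ P, w = r • (v - α)}

/-- A set is a simplicial cone if it is the conic hull of a finite linearly independent set. -/
def IsSimplicialCone (C : Set V) : Prop :=
  ∃ K : PointedCone ℝ V, K.IsSimplicial ∧ (K : Set V) = C

/-- A simple convex polytope on the lattice `M`: its extreme points lie in `M`, and its tangent
cone at each of them is simplicial. -/
structure IsSimpleLatticePolytope (M : Submodule ℤ V) (P : Set V) : Prop where
  isConvexPolytope : IsConvexPolytope P
  extremePoints_subset : P.extremePoints ℝ ⊆ (M : Set V)
  simple : ∀ α ∈ P.extremePoints ℝ, IsSimplicialCone (tangentCone P α)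

/-- The primitive generators in `M` of a strongly convex cone `C`: the nonzero elements of
`C ∩ M` that span an extremal ray of `C` and are not a proper multiple of an element of `M`. -/
def primitiveGenerators (M : Submodule ℤ V) (C : Set V) : Set M :=
  {l | l ≠ 0 ∧ (l : V) ∈ C ∧
    (∀ x ∈ C, ∀ y ∈ C, x + y = (l : V) → ∃ t : ℝ, 0 ≤ t ∧ x = t • (l : V)) ∧
    (∀ (k : ℕ) (m : M), l = k • m → k = 1)}

/-- The half-open unit parallelepiped `{∑ aᵢ λᵢ | 0 ≤ aᵢ < 1}` on the primitive generators `λᵢ`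
(a finite set when `C` is simplicial). -/
def unitParallelepiped (M : Submodule ℤ V) (C : Set V) : Set V :=
  {v | ∃ a : M → ℝ, (∀ l, 0 ≤ a l ∧ a l < 1) ∧
    v = ∑ᶠ l ∈ primitiveGenerators M C, a l • (l : V)}

end Convex

section RationalFunctions

variable {V : Type*} [AddCommGroup V] [Module ℝ V]

instance instTwoUniqueSums (M : Submodule ℤ V) : TwoUniqueSums M :=
  letI : Module ℚ V := Module.compHom V (algebraMap ℚ ℝ)
  TwoUniqueSums.of_injective_addHom M.subtype.toAddMonoidHom.toAddHom
    Subtype.val_injective inferInstance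

instance instIsDomain (M : Submodule ℤ V) : IsDomain ℂ[M] :=
  NoZeroDivisors.to_isDomain _

/-- `ℂ(M)`, the field of fractions of the group algebra `ℂ[M]`. -/
abbrev RationalFunctions (M : Submodule ℤ V) : Type _ := FractionRing ℂ[M]

/-- The element `e(m)` of `ℂ(M)`. -/
def e {M : Submodule ℤ V} (m : M) : RationalFunctions M :=
  algebraMap ℂ[M] (RationalFunctions M) (single m 1)

/-- The characteristic polynomial `∑_{m ∈ S} e(m) ∈ ℂ[M]` of a finite set `S` of lattice points. -/
def charPoly {M : Submodule ℤ V} (S : Set M) : ℂ[M] :=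
  ∑ᶠ m ∈ S, single m (1 : ℂ)

end RationalFunctions

variable {V : Type*} [NormedAddCommGroup V] [NormedSpace ℝ V]

/-- The characteristic function `ν^M_C ∈ ℂ(M)` of a simplicial cone `C` with apex the origin. -/
def charFun (M : Submodule ℤ V) (C : Set V) : RationalFunctions M :=
  (∑ᶠ c ∈ {c : M | (c : V) ∈ unitParallelepiped M C}, e c) *
    ∏ᶠ l ∈ primitiveGenerators M C, (1 - e l)⁻¹

/-- The characteristic function `ν^M_{α + C} = e(α) ν^M_C` of the translate of `C` by `α ∈ M`. -/
def charFunTranslate (M : Submodule ℤ V) (α : M) (C : Set V) : RationalFunctions M :=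
  e α * charFun M C

end Brion

end

noncomputable section

namespace Brion

open AddMonoidAlgebra

/-! Let `p i` be the vertices and, for a set `J` of indices, let `partialHull p J` be the affine
combinations whose coefficients outside `J` are non-negative. The indicators of these sets, with
signs `(-1) ^ J.card`, sum to zero (`sum_signed_partialHull_eq_zero`). Indeed the coefficient
vectors of a fixed point form polyhedra whose signed indicators cancel, because coefficients with
sum 1 are not all negative; the Euler characteristic turns this into a relation counting the
nonempty polyhedra.

A function on `M` that some nonzero Laurent polynomial multiplies into a Laurent polynomial
determines a unique rational function, additively (`Represents`). For `J = ∅` the set is the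
polytope and gives its character sum. For `J = {i}` it is the tangent cone translated to `p i` and
gives `charFunTranslate`, by summing geometric series. For larger `J` it is invariant under `p i - p
j` with `i, j ∈ J` distinct, and gives 0. The signed relation thus becomes Brion's formula. -/

/-! ### Euler characteristic of compact convex sets -/

open scoped Classical in
/-- The Euler characteristic is a well-defined linear functional on the span of the indicator
functions of compact intervals. -/
theorem sum_nonempty_eq_zero_real {ι : Type*} (s : Finset ι) (c : ι → ℤ) (K : ι → Set ℝ)
    (hcomp : ∀ i, IsCompact (K i)) (hconv : ∀ i, Convex ℝ (K i))
    (h : ∀ t, ∑ i ∈ s, (if t ∈ K i then c i else 0) = 0) :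
    ∑ i ∈ s, (if (K i).Nonempty then c i else 0) = 0 := by
  -- The indicator of "`t` is the maximum of `K i`" is the jump of the indicator of `K i` just to
  -- the right of `t`, so the linear relation passes to maxima.
  have hright : ∀ t i, ∀ᶠ u in nhdsWithin t (Set.Ioi t),
      (u ∈ K i ↔ (t ∈ K i ∧ ¬ IsGreatest (K i) t)) := by
    intro t i
    by_cases ht : ∃ b ∈ K i, t < b
    · obtain ⟨b, hb, htb⟩ := ht
      by_cases htK : t ∈ K i
      · filter_upwards [Ioo_mem_nhdsGT htb] with u hu
        have h1 : u ∈ K i := (hconv i).ordConnected.out htK hb ⟨hu.1.le, hu.2.le⟩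
        have h2 : ¬ IsGreatest (K i) t := fun hg => absurd (hg.2 hb) (not_le.2 htb)
        tauto
      · have : ∀ᶠ u in nhds t, u ∉ K i := (hcomp i).isClosed.isOpen_compl.mem_nhds htK
        filter_upwards [nhdsWithin_le_nhds this] with u hu
        tauto
    · push Not at ht
      filter_upwards [self_mem_nhdsWithin] with u hu
      have h1 : u ∉ K i := fun hK => absurd (ht u hK) (not_le.2 hu)
      have h2 : t ∈ K i → IsGreatest (K i) t := fun hK => ⟨hK, fun b hb => ht b hb⟩
      tauto
  have hgreat : ∀ t, ∑ i ∈ s, (if IsGreatest (K i) t then c i else 0) = 0 := by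
    intro t
    have hall : ∀ᶠ u in nhdsWithin t (Set.Ioi t), ∀ i ∈ s,
        (u ∈ K i ↔ (t ∈ K i ∧ ¬ IsGreatest (K i) t)) :=
      (Filter.eventually_all_finset s).2 fun i _ => hright t i
    obtain ⟨u, hu⟩ := hall.exists
    have e1 : ∑ i ∈ s, (if IsGreatest (K i) t then c i else 0)
        = ∑ i ∈ s, (if t ∈ K i then c i else 0) - ∑ i ∈ s, (if u ∈ K i then c i else 0) := by
      rw [← Finset.sum_sub_distrib]
      refine Finset.sum_congr rfl fun i hi => ?_
      have h1 := hu i hi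
      have h2 : IsGreatest (K i) t → t ∈ K i := fun hg => hg.1
      by_cases hg : IsGreatest (K i) t <;> by_cases ht : t ∈ K i <;> simp_all
    rw [e1, h, h, sub_zero]
  -- A nonempty compact set has exactly one maximum, so counting maxima counts nonempty sets.
  have hsum : ∀ i ∈ s, (if (K i).Nonempty then c i else 0) =
      ∑ t ∈ s.image (fun i => sSup (K i)), (if IsGreatest (K i) t then c i else 0) := by
    intro i hi
    by_cases hne : (K i).Nonempty
    · have hg := (hcomp i).isGreatest_sSup hne
      rw [if_pos hne, Finset.sum_eq_single (sSup (K i)), if_pos hg]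
      · intro t _ ht
        rw [if_neg fun hg' => ht (hg'.unique hg)]
      · intro hmem
        exact absurd (Finset.mem_image_of_mem _ hi) hmem
    · rw [if_neg hne]
      refine (Finset.sum_eq_zero fun t _ => if_neg fun hg => hne ⟨t, hg.1⟩).symm
  rw [Finset.sum_congr rfl hsum, Finset.sum_comm]
  exact Finset.sum_eq_zero fun t _ => hgreat t

-- Project away the first coordinate: the one-dimensional case on each fibre shows that the
-- projected sets satisfy the same relation, and projection preserves nonemptiness.
open scoped Classical in
theorem sum_nonempty_eq_zero_pi {ι : Type*} (s : Finset ι) (c : ι → ℤ) (n : ℕ) :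
    ∀ (K : ι → Set (Fin n → ℝ)), (∀ i, IsCompact (K i)) → (∀ i, Convex ℝ (K i)) →
      (∀ t, ∑ i ∈ s, (if t ∈ K i then c i else 0) = 0) →
      ∑ i ∈ s, (if (K i).Nonempty then c i else 0) = 0 := by
  induction n with
  | zero =>
    intro K _ _ h
    refine Eq.trans ?_ (h default)
    refine Finset.sum_congr rfl fun i _ => ?_
    congr 1
    exact propext ⟨fun ⟨x, hx⟩ => by rwa [Subsingleton.elim default x], fun hx => ⟨_, hx⟩⟩
  | succ n ih =>
    intro K hcomp hconv h
    let π : (Fin (n + 1) → ℝ) →ₗ[ℝ] (Fin n → ℝ) := LinearMap.funLeft ℝ ℝ Fin.succ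
    have hπ : ∀ w j, π w j = w (Fin.succ j) := fun _ _ => rfl
    have key := ih (fun i => π '' K i)
      (fun i => (hcomp i).image (LinearMap.continuous_of_finiteDimensional π))
      (fun i => (hconv i).linear_image π) ?_
    · simpa only [Set.image_nonempty] using key
    · intro y
      have hfib := sum_nonempty_eq_zero_real s c
        (fun i => {t : ℝ | (Fin.cons t y : Fin (n + 1) → ℝ) ∈ K i}) ?_ ?_ (fun t => h _)
      · refine Eq.trans ?_ hfib
        refine Finset.sum_congr rfl fun i _ => ?_
        congr 1
        refine propext ⟨?_, ?_⟩
        · rintro ⟨w, hw, rfl⟩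
          refine ⟨w 0, ?_⟩
          have : (Fin.cons (w 0) (π w) : Fin (n + 1) → ℝ) = w := Fin.cons_self_tail w
          simpa [this] using hw
        · rintro ⟨t, ht⟩
          exact ⟨_, ht, by ext j; simp [hπ]⟩
      · intro i
        have hcl : IsClosed {t : ℝ | (Fin.cons t y : Fin (n + 1) → ℝ) ∈ K i} :=
          (hcomp i).isClosed.preimage (by fun_prop)
        refine ((hcomp i).image (continuous_apply (0 : Fin (n + 1)))).of_isClosed_subset hcl ?_
        intro t ht
        exact ⟨_, ht, by simp⟩
      · intro i t ht u hu a b ha hb hab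
        have := hconv i ht hu ha hb hab
        simp only [Set.mem_ofPred_eq]
        convert this using 1
        ext j
        refine Fin.cases ?_ (fun j => ?_) j
        · simp
        · simp [← add_mul, hab]

open scoped Classical in
/-- The Euler characteristic is a well-defined linear functional on the span of the indicator
functions of compact convex sets. -/
theorem sum_nonempty_eq_zero {ι E : Type*} [NormedAddCommGroup E] [NormedSpace ℝ E]
    [FiniteDimensional ℝ E] (s : Finset ι) (c : ι → ℤ) (K : ι → Set E)
    (hcomp : ∀ i, IsCompact (K i)) (hconv : ∀ i, Convex ℝ (K i))
    (h : ∀ t, ∑ i ∈ s, (if t ∈ K i then c i else 0) = 0) :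
    ∑ i ∈ s, (if (K i).Nonempty then c i else 0) = 0 := by
  let φ : E ≃L[ℝ] (Fin (Module.finrank ℝ E) → ℝ) :=
    ContinuousLinearEquiv.ofFinrankEq (by simp)
  have key := sum_nonempty_eq_zero_pi s c _ (fun i => φ '' K i)
    (fun i => (hcomp i).image φ.continuous)
    (fun i => (hconv i).linear_image φ.toLinearEquiv.toLinearMap) ?_
  · simpa only [Set.image_nonempty] using key
  · intro t
    refine Eq.trans ?_ (h (φ.symm t))
    refine Finset.sum_congr rfl fun i _ => ?_
    congr 1
    refine propext ⟨?_, fun ht => ⟨_, ht, by simp⟩⟩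
    rintro ⟨w, hw, rfl⟩
    simpa using hw

/-! ### The Gram relation for partial hulls -/

section Hull

variable {ι V : Type*} [Fintype ι] [NormedAddCommGroup V] [NormedSpace ℝ V]

/-- The affine combinations of the points `p i` in which only the coefficients with index in `J`
may be negative. -/
def partialHull (p : ι → V) (J : Finset ι) : Set V :=
  {x | ∃ w : ι → ℝ, ∑ i, w i = 1 ∧ (∀ i ∉ J, 0 ≤ w i) ∧ ∑ i, w i • p i = x}

-- The sum is the expansion of a product of factors `-1 + [0 ≤ w i]`, one of which vanishes.
open scoped Classical in
theorem sum_signed_nonneg_eq_zero (w : ι → ℝ) (hw : ∃ i, 0 ≤ w i) :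
    ∑ J : Finset ι, (if ∀ i ∉ J, 0 ≤ w i then (-1 : ℤ) ^ J.card else 0) = 0 := by
  obtain ⟨i, hi⟩ := hw
  have h0 : ∏ i, ((-1 : ℤ) + if 0 ≤ w i then 1 else 0) = 0 :=
    Finset.prod_eq_zero (Finset.mem_univ i) (by simp [hi])
  rw [Finset.prod_add, Finset.powerset_univ] at h0
  refine Eq.trans ?_ h0
  refine Finset.sum_congr rfl fun J _ => ?_
  rw [Finset.prod_const, Finset.prod_ite_zero]
  simp

open scoped Classical in
/-- The Gram relation for the convex hull of the points `p i`. -/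
theorem sum_signed_partialHull_eq_zero [FiniteDimensional ℝ V] (p : ι → V) (x : V) :
    ∑ J : Finset ι, (if x ∈ partialHull p J then (-1 : ℤ) ^ J.card else 0) = 0 := by
  let K : Finset ι → Set (ι → ℝ) := fun J =>
    {w | ∑ i, w i = 1 ∧ (∀ i ∉ J, 0 ≤ w i) ∧ ∑ i, w i • p i = x}
  -- The sets `K J` may be unbounded. One large ball meets every nonempty `K J`, so truncating by it
  -- gives compactness without changing which are empty.
  have hR : ∃ R : ℝ, ∀ J, (K J).Nonempty → (K J ∩ Metric.closedBall 0 R).Nonempty := by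
    have : ∀ J, ∃ r : ℝ, (K J).Nonempty → ∃ w ∈ K J, ‖w‖ ≤ r := by
      intro J
      by_cases h : (K J).Nonempty
      · obtain ⟨w, hw⟩ := h
        exact ⟨‖w‖, fun _ => ⟨w, hw, le_rfl⟩⟩
      · exact ⟨0, fun h' => absurd h' h⟩
    choose r hr using this
    refine ⟨∑ J, |r J|, fun J hJ => ?_⟩
    obtain ⟨w, hw, hwr⟩ := hr J hJ
    refine ⟨w, hw, ?_⟩
    rw [mem_closedBall_zero_iff]
    exact (hwr.trans (le_abs_self _)).trans
      (Finset.single_le_sum (f := fun J => |r J|) (fun _ _ => abs_nonneg _) (Finset.mem_univ J))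
  obtain ⟨R, hR⟩ := hR
  have key := sum_nonempty_eq_zero Finset.univ (fun J : Finset ι => (-1 : ℤ) ^ J.card)
    (fun J => K J ∩ Metric.closedBall 0 R) ?_ ?_ ?_
  · refine Eq.trans ?_ key
    refine Finset.sum_congr rfl fun J _ => ?_
    congr 1
    exact propext ⟨fun h => hR J h, fun h => h.mono Set.inter_subset_left⟩
  · intro J
    refine (isCompact_closedBall _ _).inter_left ?_
    refine (isClosed_eq (by fun_prop) continuous_const).inter (IsClosed.inter ?_
      (isClosed_eq (by fun_prop) continuous_const))
    have : {w : ι → ℝ | ∀ i ∉ J, 0 ≤ w i} = ⋂ i, ⋂ (_ : i ∉ J), {w | 0 ≤ w i} := by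
      ext w; simp
    change IsClosed {w : ι → ℝ | ∀ i ∉ J, 0 ≤ w i}
    rw [this]
    exact isClosed_iInter fun i => isClosed_iInter fun _ =>
      isClosed_le continuous_const (continuous_apply i)
  · intro J
    refine Convex.inter ?_ (convex_closedBall _ _)
    rintro w ⟨hw1, hw2, hw3⟩ u ⟨hu1, hu2, hu3⟩ a b ha hb hab
    refine ⟨?_, fun i hi => ?_, ?_⟩
    · simp [Finset.sum_add_distrib, ← Finset.mul_sum, hw1, hu1, hab]
    · exact add_nonneg (mul_nonneg ha (hw2 i hi)) (mul_nonneg hb (hu2 i hi))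
    · simp only [Pi.add_apply, Pi.smul_apply, smul_eq_mul, add_smul, mul_smul,
        Finset.sum_add_distrib, ← Finset.smul_sum, hw3, hu3]
      rw [← add_smul, hab, one_smul]
  · intro w
    by_cases hw : (∑ i, w i = 1 ∧ ∑ i, w i • p i = x) ∧ w ∈ Metric.closedBall (0 : ι → ℝ) R
    · have hpos : ∃ i, 0 ≤ w i := by
        by_contra! hneg
        have : ∑ i, w i ≤ 0 := Finset.sum_nonpos fun i _ => (hneg i).le
        linarith [hw.1.1]
      refine Eq.trans ?_ (sum_signed_nonneg_eq_zero w hpos)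
      refine Finset.sum_congr rfl fun J _ => ?_
      congr 1
      exact propext ⟨fun h => h.1.2.1, fun h => ⟨⟨hw.1.1, h, hw.1.2⟩, hw.2⟩⟩
    · exact Finset.sum_eq_zero fun J _ => if_neg fun h => hw ⟨⟨h.1.1, h.1.2.2⟩, h.2⟩

theorem partialHull_empty (p : ι → V) : partialHull p ∅ = convexHull ℝ (Set.range p) := by
  ext x
  constructor
  · rintro ⟨w, h1, h2, rfl⟩
    exact mem_convexHull_of_exists_fintype w p (fun i => h2 i (by simp)) h1
      (fun i => Set.mem_range_self i) rfl
  · classical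
    refine fun hx => convexHull_min ?_ ?_ hx
    · rintro _ ⟨i, rfl⟩
      refine ⟨Pi.single i 1, by simp, fun k _ => ?_, by simp [Pi.single_apply]⟩
      rw [Pi.single_apply]
      split_ifs <;> norm_num
    · rintro _ ⟨w, hw1, hw2, rfl⟩ _ ⟨u, hu1, hu2, rfl⟩ a b ha hb hab
      refine ⟨a • w + b • u, ?_, fun i hi => ?_, ?_⟩
      · simp [Finset.sum_add_distrib, ← Finset.mul_sum, hw1, hu1, hab]
      · exact add_nonneg (mul_nonneg ha (hw2 i hi)) (mul_nonneg hb (hu2 i hi))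
      · simp only [Pi.add_apply, Pi.smul_apply, smul_eq_mul, add_smul, mul_smul,
          Finset.sum_add_distrib, ← Finset.smul_sum]

/-- Weight can be moved from `j` to `i` freely, since neither coefficient is constrained. This
periodicity kills the terms with two or more indices. -/
theorem partialHull_add_sub_mem (p : ι → V) {J : Finset ι} {i j : ι} (hi : i ∈ J) (hj : j ∈ J)
    {x : V} (hx : x ∈ partialHull p J) : x + (p i - p j) ∈ partialHull p J := by
  classical
  obtain ⟨w, h1, h2, rfl⟩ := hx
  refine ⟨fun k => w k + ((if k = i then 1 else 0) - if k = j then 1 else 0), ?_, ?_, ?_⟩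
  · simp [Finset.sum_add_distrib, h1]
  · intro k hk
    have hki : k ≠ i := fun h => hk (h ▸ hi)
    have hkj : k ≠ j := fun h => hk (h ▸ hj)
    simpa [hki, hkj] using h2 k hk
  · simp [Finset.sum_add_distrib, add_smul, sub_smul]

theorem mem_partialHull_singleton_iff (p : ι → V) (i : ι) (x : V) :
    x ∈ partialHull p {i} ↔ x - p i ∈ tangentCone (partialHull p ∅) (p i) := by
  classical
  constructor
  · rintro ⟨w, h1, h2, rfl⟩
    -- Adding `|w i|` to the coefficient at `i` makes it non-negative and raises the total to `1 +
    -- |w i|`, the dilation factor.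
    have hr : (0 : ℝ) < 1 + |w i| := by positivity
    refine ⟨1 + |w i|, hr.le, _, ⟨fun k => (1 + |w i|)⁻¹ * (w k + if k = i then |w i| else 0),
      ?_, ?_, rfl⟩, ?_⟩
    · rw [← Finset.mul_sum, Finset.sum_add_distrib, h1]
      simp [hr.ne']
    · intro k _
      refine mul_nonneg (by positivity) ?_
      by_cases hk : k = i
      · subst hk
        simpa using neg_le_iff_add_nonneg'.1 (neg_le_abs (w k))
      · simpa [hk] using h2 k (by simpa using hk)
    · simp only [mul_smul, ← Finset.smul_sum]
      rw [smul_sub, smul_inv_smul₀ hr.ne']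
      simp only [add_smul, Finset.sum_add_distrib, ite_smul, zero_smul, Finset.sum_ite_eq',
        Finset.mem_univ, if_true, one_smul]
      abel
  · rintro ⟨r, hr, v, ⟨u, h1, h2, rfl⟩, hx⟩
    refine ⟨fun k => r * u k + if k = i then 1 - r else 0, ?_, ?_, ?_⟩
    · simp [Finset.sum_add_distrib, ← Finset.mul_sum, h1]
    · intro k hk
      have hki : k ≠ i := by simpa using hk
      simpa [hki] using mul_nonneg hr (h2 k (by simp))
    · rw [sub_eq_iff_eq_add.1 hx]
      simp [Finset.sum_add_distrib, add_smul, mul_smul, ← Finset.smul_sum, sub_smul, smul_sub]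
      abel

end Hull

/-! ### Functions on the lattice representing rational functions -/

section Shift

variable {G : Type*} [AddCommGroup G]

/-- The action of the group algebra on arbitrary functions on the group, in which `e(k)` translates
by `k`. -/
def shift : ℂ[G] →ₐ[ℂ] Module.End ℂ (G → ℂ) :=
  AddMonoidAlgebra.lift ℂ (Module.End ℂ (G → ℂ)) G
    { toFun := fun k => LinearMap.funLeft ℂ ℂ fun m => m - k.toAdd
      map_one' := by ext; simp [LinearMap.funLeft]
      map_mul' := fun k l => by
        ext F m
        simp [LinearMap.funLeft, sub_sub] }

theorem shift_single (k : G) (F : G → ℂ) (m : G) : shift (single k 1) F m = F (m - k) := by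
  simp [shift, LinearMap.funLeft]

theorem shift_coeff (g h : ℂ[G]) : shift g (⇑h.coeff) = ⇑(g * h).coeff := by
  induction g using AddMonoidAlgebra.induction_linear with
  | zero => simp
  | add f g hf hg => ext m; simp [add_mul, hf, hg]
  | single k c =>
    ext m
    have h1 : (single k c : ℂ[G]) = c • single k 1 := by simp
    rw [h1, map_smul, LinearMap.smul_apply, Pi.smul_apply, shift_single, smul_mul_assoc]
    simp [sub_eq_add_neg, add_comm]

theorem shift_mul (g h : ℂ[G]) (F : G → ℂ) : shift (g * h) F = shift g (shift h F) := by
  rw [map_mul, Module.End.mul_apply]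

theorem one_sub_single_ne_zero {k : G} (hk : k ≠ 0) : (1 - single k 1 : ℂ[G]) ≠ 0 := by
  intro h
  have h1 : (single 0 1 : ℂ[G]) = single k 1 := by
    rw [← one_def]
    exact sub_eq_zero.1 h
  have h2 := congrArg (fun f : ℂ[G] => f.coeff 0) h1
  simp [hk] at h2

theorem shift_prod_one_sub_single {ι : Type*} [Fintype ι] (l : ι → G) (F : G → ℂ) (m : G) :
    shift (∏ i, (1 - single (l i) 1)) F m =
      ∑ J : Finset ι, (-1) ^ J.card * F (m - ∑ i ∈ J, l i) := by
  classical
  have h : (∏ i, (1 - single (l i) 1) : ℂ[G]) =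
      ∑ J : Finset ι, (-1 : ℂ) ^ J.card • single (∑ i ∈ J, l i) 1 := by
    simp only [sub_eq_neg_add]
    rw [Finset.prod_add, Finset.powerset_univ]
    refine Finset.sum_congr rfl fun J _ => ?_
    rw [Finset.prod_const_one, mul_one, Finset.prod_neg, AddMonoidAlgebra.prod_single]
    have h1 : (-1 : ℂ[G]) = algebraMap ℂ ℂ[G] (-1) := by rw [map_neg, map_one]
    rw [h1, ← map_pow, ← Algebra.smul_def, Finset.prod_const_one]
  rw [h, map_sum, LinearMap.sum_apply, Finset.sum_apply]
  refine Finset.sum_congr rfl fun J _ => ?_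
  rw [map_smul, LinearMap.smul_apply, Pi.smul_apply, shift_single, smul_eq_mul]

/-- The function `F` on `G`, viewed as a formal series, becomes a Laurent polynomial after
multiplication by a nonzero Laurent polynomial, and so represents the rational function `r`. -/
def Represents (F : G → ℂ) (r : FractionRing ℂ[G]) : Prop :=
  ∃ D N : ℂ[G], D ≠ 0 ∧ shift D F = ⇑N.coeff ∧
    algebraMap ℂ[G] (FractionRing ℂ[G]) D * r = algebraMap ℂ[G] (FractionRing ℂ[G]) N

theorem represents_coeff [Nontrivial ℂ[G]] (N : ℂ[G]) :
    Represents (⇑N.coeff) (algebraMap ℂ[G] (FractionRing ℂ[G]) N) :=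
  ⟨1, N, one_ne_zero, by simp, by simp⟩

/-- Multiplication by `1 - e(k)` annihilates a `k`-periodic function. -/
theorem represents_zero_of_invariant {F : G → ℂ} {k : G} (hk : k ≠ 0)
    (h : ∀ m, F (m - k) = F m) : Represents F 0 := by
  refine ⟨1 - single k 1, 0, one_sub_single_ne_zero hk, ?_, by simp⟩
  ext m
  simp [shift_single, h]

theorem Represents.smul {F : G → ℂ} {r : FractionRing ℂ[G]} (h : Represents F r) (n : ℤ) :
    Represents (n • F) (n • r) := by
  obtain ⟨D, N, hD, h1, h2⟩ := h
  refine ⟨D, n • N, hD, ?_, ?_⟩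
  · rw [map_zsmul, h1, coeff_smul, Finsupp.coe_smul]
  · rw [mul_smul_comm, h2, map_zsmul]

theorem Represents.translate {F : G → ℂ} {r : FractionRing ℂ[G]} (h : Represents F r) (α : G) :
    Represents (fun m => F (m - α))
      (algebraMap ℂ[G] (FractionRing ℂ[G]) (single α 1) * r) := by
  obtain ⟨D, N, hD, h1, h2⟩ := h
  refine ⟨D, single α 1 * N, hD, ?_, ?_⟩
  · have : (fun m => F (m - α)) = shift (single α 1) F := by
      ext m
      rw [shift_single]
    rw [this, ← shift_mul, mul_comm, shift_mul, h1, shift_coeff]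
  · rw [map_mul, ← h2, mul_left_comm]

variable [IsDomain ℂ[G]]

theorem Represents.add {F F' : G → ℂ} {r r' : FractionRing ℂ[G]} (h : Represents F r)
    (h' : Represents F' r') : Represents (F + F') (r + r') := by
  obtain ⟨D, N, hD, h1, h2⟩ := h
  obtain ⟨D', N', hD', h1', h2'⟩ := h'
  refine ⟨D * D', D' * N + D * N', mul_ne_zero hD hD', ?_, ?_⟩
  · rw [map_add, shift_mul D D' F', h1', mul_comm D, shift_mul, h1, shift_coeff, shift_coeff]
    ext m
    simp
  · rw [map_add, map_mul, map_mul, map_mul, ← h2, ← h2']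
    ring

theorem Represents.sum {κ : Type*} (s : Finset κ) {F : κ → G → ℂ} {r : κ → FractionRing ℂ[G]}
    (h : ∀ i ∈ s, Represents (F i) (r i)) : Represents (∑ i ∈ s, F i) (∑ i ∈ s, r i) := by
  classical
  induction s using Finset.induction_on with
  | empty =>
    simp only [Finset.sum_empty]
    exact ⟨1, 0, one_ne_zero, by simp, by simp⟩
  | insert a s ha ih =>
    rw [Finset.sum_insert ha, Finset.sum_insert ha]
    exact (h a (Finset.mem_insert_self a s)).add
      (ih fun i hi => h i (Finset.mem_insert_of_mem hi))

/-- Applying both denominators to `F` in either order gives `D' * N = D * N'`. -/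
theorem Represents.unique {F : G → ℂ} {r r' : FractionRing ℂ[G]} (h : Represents F r)
    (h' : Represents F r') : r = r' := by
  obtain ⟨D, N, hD, h1, h2⟩ := h
  obtain ⟨D', N', hD', h1', h2'⟩ := h'
  have key : D' * N = D * N' := by
    have : (⇑(D' * N).coeff : G → ℂ) = ⇑(D * N').coeff := by
      rw [← shift_coeff, ← h1, ← shift_mul, mul_comm, shift_mul, h1', shift_coeff]
    exact AddMonoidAlgebra.ext (DFunLike.coe_injective this)
  have hinj := IsFractionRing.injective ℂ[G] (FractionRing ℂ[G])
  have hDD : algebraMap ℂ[G] (FractionRing ℂ[G]) (D * D') ≠ 0 :=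
    (map_ne_zero_iff _ hinj).2 (mul_ne_zero hD hD')
  refine mul_left_cancel₀ hDD ?_
  have key' := congrArg (algebraMap ℂ[G] (FractionRing ℂ[G])) key
  rw [map_mul, map_mul, ← h2, ← h2'] at key'
  rw [map_mul]
  linear_combination key'

end Shift

/-! ### Simplicial cones and their rays -/

section Cones

variable {ι κ V : Type*} [Fintype ι] [NormedAddCommGroup V] [NormedSpace ℝ V]

/-- The cone of non-negative combinations of a finite family of vectors. -/
def coneOver (v : ι → V) : Set V :=
  {x | ∃ a : ι → ℝ, (∀ i, 0 ≤ a i) ∧ ∑ i, a i • v i = x}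

theorem sum_smul_mem_coneOver_iff {v : ι → V} (hv : LinearIndependent ℝ v) (a : ι → ℝ) :
    ∑ i, a i • v i ∈ coneOver v ↔ ∀ i, 0 ≤ a i := by
  refine ⟨?_, fun h => ⟨a, h, rfl⟩⟩
  rintro ⟨b, hb, hab⟩ i
  rw [← Fintype.linearIndependent_iffₛ.1 hv b a hab i]
  exact hb i

theorem smul_mem_coneOver (v : ι → V) (i : ι) {t : ℝ} (ht : 0 ≤ t) : t • v i ∈ coneOver v := by
  classical
  refine ⟨Pi.single i t, fun j => ?_, by simp [Pi.single_apply]⟩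
  rw [Pi.single_apply]
  split_ifs <;> simp [ht]

theorem mem_coneOver (v : ι → V) (i : ι) : v i ∈ coneOver v := by
  simpa using smul_mem_coneOver v i zero_le_one

theorem coneOver_pos_smul {t : ι → ℝ} (ht : ∀ i, 0 < t i) (v : ι → V) :
    coneOver (fun i => t i • v i) = coneOver v := by
  ext x
  constructor
  · rintro ⟨a, ha, rfl⟩
    exact ⟨fun i => a i * t i, fun i => mul_nonneg (ha i) (ht i).le, by simp [mul_smul]⟩
  · rintro ⟨a, ha, rfl⟩
    refine ⟨fun i => a i / t i, fun i => div_nonneg (ha i) (ht i).le, ?_⟩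
    refine Finset.sum_congr rfl fun i _ => ?_
    rw [smul_smul, div_mul_cancel₀ _ (ht i).ne']

theorem IsSimplicialCone.exists_eq_coneOver {C : Set V} (hC : IsSimplicialCone C) :
    ∃ s : Finset V, LinearIndependent ℝ (fun x : s => (x : V)) ∧
      C = coneOver (fun x : s => (x : V)) := by
  classical
  obtain ⟨K, ⟨s, hs, hli, rfl⟩, rfl⟩ := hC
  lift s to Finset V using hs
  refine ⟨s, hli, ?_⟩
  ext x
  rw [SetLike.mem_coe, PointedCone.mem_hull_set]
  constructor
  · rintro ⟨c, hc, h0, rfl⟩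
    refine ⟨fun i => c i, fun i => h0 _, ?_⟩
    rw [Finsupp.sum_of_support_subset c (s := s) (by exact_mod_cast hc) _ (by simp)]
    exact Finset.sum_coe_sort s (fun y => c y • y)
  · rintro ⟨a, ha, rfl⟩
    refine ⟨Finsupp.onFinset s (fun y => if h : y ∈ s then a ⟨y, h⟩ else 0) ?_, ?_, ?_, ?_⟩
    · intro y hy
      by_contra h
      simp [h] at hy
    · exact_mod_cast Finsupp.support_onFinset_subset
    · intro y
      simp only [Finsupp.onFinset_apply]
      split_ifs
      · exact ha _
      · exact le_rfl
    · rw [Finsupp.onFinset_sum _ (by simp), ← Finset.sum_coe_sort]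
      refine Finset.sum_congr rfl fun i _ => ?_
      simp

/-- If a simplicial cone is also generated by the vectors `q k`, then some `q k` lies on each of
its extremal rays. -/
theorem exists_mem_ray [Fintype κ] {v : ι → V} (hv : LinearIndependent ℝ v) {q : κ → V}
    (h : coneOver v = coneOver q) (i : ι) : ∃ k, ∃ t : ℝ, 0 < t ∧ q k = t • v i := by
  classical
  obtain ⟨a, ha, hav⟩ : v i ∈ coneOver q := h ▸ mem_coneOver v i
  have hq : ∀ k, ∃ b : ι → ℝ, (∀ j, 0 ≤ b j) ∧ ∑ j, b j • v j = q k := fun k => by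
    have : q k ∈ coneOver v := h ▸ mem_coneOver q k
    exact this
  choose b hb hbq using hq
  have hsum : ∑ j, (∑ k, a k * b k j) • v j = ∑ j, (Pi.single i 1 : ι → ℝ) j • v j := by
    have e1 : ∑ j, (Pi.single i 1 : ι → ℝ) j • v j = v i := by simp [Pi.single_apply]
    rw [e1, ← hav]
    simp only [Finset.sum_smul, mul_smul]
    rw [Finset.sum_comm]
    simp only [← Finset.smul_sum, hbq]
  have hcoef := Fintype.linearIndependent_iffₛ.1 hv _ _ hsum
  have hi : ∑ k, a k * b k i ≠ 0 := by rw [hcoef i]; simp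
  obtain ⟨k, -, hk⟩ := Finset.exists_ne_zero_of_sum_ne_zero hi
  have hbk : b k i ≠ 0 := right_ne_zero_of_mul hk
  refine ⟨k, b k i, lt_of_le_of_ne (hb k i) hbk.symm, ?_⟩
  rw [← hbq k]
  refine Finset.sum_eq_single i (fun j _ hj => ?_) (by simp)
  -- All terms are non-negative, so a generator `q k` used with nonzero weight has no component off
  -- the ray of `v i`.
  have hj0 : ∑ k, a k * b k j = 0 := by rw [hcoef j]; simp [hj]
  have := (Finset.sum_eq_zero_iff_of_nonneg
    (fun k _ => mul_nonneg (ha k) (hb k j))).1 hj0 k (Finset.mem_univ k)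
  rw [(mul_eq_zero.1 this).resolve_left (left_ne_zero_of_mul hk), zero_smul]

/-- Exhibits generators `p k - p i` that are lattice vectors when the vertices are; hence the rays
of the tangent cone are rational. -/
theorem tangentCone_partialHull_empty (p : ι → V) (i : ι) :
    tangentCone (partialHull p ∅) (p i) = coneOver (fun k => p k - p i) := by
  ext x
  have hx : x = (x + p i) - p i := by abel
  conv_lhs => rw [hx]
  rw [← mem_partialHull_singleton_iff]
  classical
  constructor
  · rintro ⟨w, h1, h2, h3⟩
    refine ⟨fun k => if k = i then 0 else w k, fun k => ?_, ?_⟩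
    · by_cases hk : k = i
      · simp [hk]
      · simpa [hk] using h2 k (by simpa using hk)
    · have h4 : x = ∑ k, w k • (p k - p i) := by
        simp only [smul_sub, Finset.sum_sub_distrib, ← Finset.sum_smul, h1, h3]
        simp
      rw [h4]
      refine Finset.sum_congr rfl fun k _ => ?_
      by_cases hk : k = i <;> simp [hk]
  · rintro ⟨a, ha, rfl⟩
    refine ⟨fun k => a k + if k = i then 1 - ∑ k, a k else 0, ?_, fun k hk => ?_, ?_⟩
    · simp [Finset.sum_add_distrib]
    · have hki : k ≠ i := by simpa using hk
      simpa [hki] using ha k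
    · simp [Finset.sum_add_distrib, add_smul, smul_sub, sub_smul, Finset.sum_smul]
      abel

end Cones

/-! ### Primitive generators and the rational function of a cone -/

section Lattice

variable {V : Type*} [NormedAddCommGroup V] [NormedSpace ℝ V] {M : Submodule ℤ V}

theorem mem_unitParallelepiped_iff {ι : Type*} [Fintype ι] {C : Set V} {l : ι → M}
    (hinj : Function.Injective l) (hl : primitiveGenerators M C = Set.range l) (x : V) :
    x ∈ unitParallelepiped M C ↔
      ∃ a : ι → ℝ, (∀ i, 0 ≤ a i ∧ a i < 1) ∧ ∑ i, a i • (l i : V) = x := by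
  classical
  have hsum : ∀ a : M → ℝ, ∑ᶠ m ∈ primitiveGenerators M C, a m • (m : V)
      = ∑ i, a (l i) • (l i : V) := fun a => by
    rw [hl, finsum_mem_range hinj, finsum_eq_sum_of_fintype]
  constructor
  · rintro ⟨a, ha, rfl⟩
    exact ⟨fun i => a (l i), fun i => ha _, (hsum a).symm⟩
  · rintro ⟨a, ha, rfl⟩
    refine ⟨Function.extend l a 0, fun m => ?_, ?_⟩
    · by_cases hm : ∃ i, l i = m
      · obtain ⟨i, rfl⟩ := hm
        rw [hinj.extend_apply]
        exact ha i
      · rw [Function.extend_apply' _ _ _ hm]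
        simp
    · rw [hsum]
      simp only [hinj.extend_apply]

theorem isBounded_unitParallelepiped {ι : Type*} [Fintype ι] {C : Set V} {l : ι → M}
    (hinj : Function.Injective l) (hl : primitiveGenerators M C = Set.range l) :
    Bornology.IsBounded (unitParallelepiped M C) := by
  rw [isBounded_iff_forall_norm_le]
  refine ⟨∑ i, ‖(l i : V)‖, fun x hx => ?_⟩
  obtain ⟨a, ha, rfl⟩ := (mem_unitParallelepiped_iff hinj hl x).1 hx
  refine (norm_sum_le _ _).trans (Finset.sum_le_sum fun i _ => ?_)
  rw [norm_smul, Real.norm_of_nonneg (ha i).1]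
  exact mul_le_of_le_one_left (norm_nonneg _) (ha i).2.le

open scoped Classical in
/-- The lattice points of a simplicial cone and of its half-open unit parallelepiped. -/
theorem sum_signed_coneOver {ι : Type*} [Fintype ι] {l : ι → M}
    (hli : LinearIndependent ℝ (fun i => (l i : V)))
    (hl : primitiveGenerators M (coneOver fun i => (l i : V)) = Set.range l) (m : M) :
    ∑ J : Finset ι, (-1) ^ J.card *
        (if ((m - ∑ i ∈ J, l i : M) : V) ∈ coneOver (fun i => (l i : V)) then (1 : ℂ) else 0) =
      if (m : V) ∈ unitParallelepiped M (coneOver fun i => (l i : V)) then 1 else 0 := by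
  have hinj : Function.Injective l := Function.Injective.of_comp (f := Subtype.val) hli.injective
  rw [mem_unitParallelepiped_iff hinj hl]
  have hsub : ∀ (J : Finset ι) (a : ι → ℝ), ∑ i, (a i - if i ∈ J then 1 else 0) • (l i : V)
      = ∑ i, a i • (l i : V) - ∑ i ∈ J, (l i : V) := fun J a => by
    simp [sub_smul, Finset.sum_sub_distrib]
  by_cases hm : ∃ a : ι → ℝ, ∑ i, a i • (l i : V) = m
  · obtain ⟨a, ha⟩ := hm
    have hQ : (∃ b : ι → ℝ, (∀ i, 0 ≤ b i ∧ b i < 1) ∧ ∑ i, b i • (l i : V) = m) ↔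
        ∀ i, 0 ≤ a i ∧ a i < 1 := by
      refine ⟨?_, fun h => ⟨a, h, ha⟩⟩
      rintro ⟨b, hb, hbm⟩ i
      rw [← Fintype.linearIndependent_iffₛ.1 hli b a (hbm.trans ha.symm) i]
      exact hb i
    -- Subtracting the generators in `J` lowers exactly those coordinates by 1.
    have hJ : ∀ J : Finset ι, ((m - ∑ i ∈ J, l i : M) : V) ∈ coneOver (fun i => (l i : V)) ↔
        (∀ i ∈ J, 1 ≤ a i) ∧ ∀ i ∈ Finset.univ \ J, 0 ≤ a i := fun J => by
      have : ((m - ∑ i ∈ J, l i : M) : V) = ∑ i, (a i - if i ∈ J then 1 else 0) • (l i : V) := by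
        rw [hsub, ha]
        push_cast
        rfl
      rw [this, sum_smul_mem_coneOver_iff hli]
      constructor
      · refine fun h => ⟨fun i hi => ?_, fun i hi => ?_⟩
        · simpa [hi] using h i
        · have := h i
          rwa [if_neg (Finset.mem_sdiff.1 hi).2, sub_zero] at this
      · rintro ⟨h1, h2⟩ i
        by_cases hi : i ∈ J
        · simpa [hi] using h1 i hi
        · simpa [hi] using h2 i (by simpa using hi)
    simp only [hJ, hQ]
    -- Coordinatewise, `[0 ≤ a i] - [1 ≤ a i]` is the indicator of `[0, 1)`.
    have hprod : ∏ i, (-(if 1 ≤ a i then (1 : ℂ) else 0) + if 0 ≤ a i then 1 else 0) =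
        if ∀ i, 0 ≤ a i ∧ a i < 1 then 1 else 0 := by
      have : ∀ i, (-(if 1 ≤ a i then (1 : ℂ) else 0) + if 0 ≤ a i then 1 else 0) =
          if 0 ≤ a i ∧ a i < 1 then 1 else 0 := fun i => by
        by_cases h1 : 1 ≤ a i
        · have h0 : 0 ≤ a i := by linarith
          simp [h1, h0, not_lt.2 h1]
        · by_cases h0 : 0 ≤ a i
          · simp [h1, h0, not_le.1 h1]
          · simp [h1, h0]
      simp only [this]
      rw [Finset.prod_ite_zero]
      simp
    rw [← hprod, Finset.prod_add, Finset.powerset_univ]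
    refine Finset.sum_congr rfl fun J _ => ?_
    rw [Finset.prod_neg, Finset.prod_ite_zero, Finset.prod_ite_zero, mul_assoc]
    congr 1
    rw [ite_and, ite_mul, Finset.prod_const_one, Finset.prod_const_one, one_mul, zero_mul]
    congr
  · rw [if_neg fun ⟨a, _, ha⟩ => hm ⟨a, ha⟩]
    refine Finset.sum_eq_zero fun J _ => ?_
    rw [if_neg, mul_zero]
    rintro ⟨a, _, ha⟩
    refine hm ⟨fun i => a i - -(if i ∈ J then 1 else 0), ?_⟩
    simp only [sub_neg_eq_add, add_smul, Finset.sum_add_distrib, ha]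
    push_cast
    simp

variable [FiniteDimensional ℝ V] [DiscreteTopology M]

variable (M) in
theorem finite_lattice_of_isBounded {B : Set V} (hB : Bornology.IsBounded B) :
    {m : M | (m : V) ∈ B}.Finite := by
  have : ProperSpace V := FiniteDimensional.proper ℝ V
  have H : IsClosed (X := V) M := @AddSubgroup.isClosed_of_discrete _ _ _ _ _
    M.toAddSubgroup (inferInstanceAs (DiscreteTopology M))
  exact ((Metric.finite_isBounded_inter_isClosed DiscreteTopology.isDiscrete
    hB H).preimage_embedding (.subtype _)).subset fun m hm => ⟨hm, m.2⟩

variable (M) in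
/-- Among the lattice points on a rational ray there is one closest to the apex. -/
theorem exists_first_on_ray {u : V} (hu : u ≠ 0) (h : ∃ m : M, ∃ t : ℝ, 0 < t ∧ (m : V) = t • u) :
    ∃ l : M, ∃ t : ℝ, 0 < t ∧ (l : V) = t • u ∧
      ∀ (m : M) (s : ℝ), 0 < s → (m : V) = s • u → t ≤ s := by
  obtain ⟨m₀, t₀, ht₀, hm₀⟩ := h
  let S : Set M := {m | (m : V) ∈ Metric.closedBall (0 : V) ‖(m₀ : V)‖} ∩
    {m | ∃ t : ℝ, 0 < t ∧ (m : V) = t • u}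
  have hS : S.Finite := (finite_lattice_of_isBounded M Metric.isBounded_closedBall).subset
    Set.inter_subset_left
  have hne : S.Nonempty := ⟨m₀, by simp, t₀, ht₀, hm₀⟩
  obtain ⟨l, ⟨hl, t, ht, hlt⟩, hmin⟩ := hS.exists_minimalFor (fun m : M => ‖(m : V)‖) S hne
  have hmin' : ∀ m ∈ S, ‖(l : V)‖ ≤ ‖(m : V)‖ := fun m hm => by
    rcases le_total ‖(l : V)‖ ‖(m : V)‖ with h | h
    · exact h
    · exact hmin hm h
  refine ⟨l, t, ht, hlt, fun m s hs hm => ?_⟩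
  have hnorm : ‖(l : V)‖ ≤ ‖(m : V)‖ := by
    by_cases hmS : ‖(m : V)‖ ≤ ‖(m₀ : V)‖
    · exact hmin' m ⟨by simpa using hmS, s, hs, hm⟩
    · have : ‖(l : V)‖ ≤ ‖(m₀ : V)‖ := by simpa using hl
      linarith
  rw [hlt, hm, norm_smul, norm_smul, Real.norm_of_nonneg ht.le, Real.norm_of_nonneg hs.le] at hnorm
  exact le_of_mul_le_mul_right hnorm (norm_pos_iff.2 hu)

/-- The primitive generators of a simplicial cone whose rays contain lattice points. -/
theorem exists_primitiveGenerators {ι : Type*} [Fintype ι] {v : ι → V}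
    (hv : LinearIndependent ℝ v) (h : ∀ i, ∃ m : M, ∃ t : ℝ, 0 < t ∧ (m : V) = t • v i) :
    ∃ l : ι → M, LinearIndependent ℝ (fun i => (l i : V)) ∧
      coneOver (fun i => (l i : V)) = coneOver v ∧
      primitiveGenerators M (coneOver v) = Set.range l := by
  classical
  choose l t ht hl hmin using fun i => exists_first_on_ray M (hv.ne_zero i) (h i)
  have hl' : (fun i => (l i : V)) = fun i => t i • v i := funext hl
  have hcone : coneOver (fun i => (l i : V)) = coneOver v := by
    rw [hl', coneOver_pos_smul ht]
  have hli : LinearIndependent ℝ (fun i => (l i : V)) := by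
    rw [hl']
    exact hv.units_smul (fun i => Units.mk0 (t i) (ht i).ne')
  refine ⟨l, hli, hcone, ?_⟩
  ext m
  constructor
  · rintro ⟨hm0, ⟨a, ha, ham⟩, hext, hprim⟩
    have : ∃ i, a i ≠ 0 := by
      by_contra! hzero
      apply hm0
      ext
      simp [← ham, hzero]
    obtain ⟨i, hi⟩ := this
    have hi0 : 0 < a i := lt_of_le_of_ne (ha i) hi.symm
    have hvi := hv.ne_zero i
    -- Extremality applied to `m = a i • v i + rest` forces `m` onto the ray of `v i`.
    obtain ⟨r, hr, hrm⟩ := hext (a i • v i) (smul_mem_coneOver v i hi0.le)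
      (∑ j ∈ Finset.univ.erase i, a j • v j)
      ⟨fun j => if j = i then 0 else a j, fun j => by by_cases hj : j = i <;> simp [hj, ha], by
        rw [← Finset.add_sum_erase _ _ (Finset.mem_univ i)]
        simp only [if_true, zero_smul, zero_add]
        refine Finset.sum_congr rfl fun j hj => ?_
        rw [if_neg (Finset.ne_of_mem_erase hj)]⟩
      (by rw [Finset.add_sum_erase _ (fun j => a j • v j) (Finset.mem_univ i), ham])
    have hr0 : r ≠ 0 := by
      rintro rfl
      rw [zero_smul] at hrm
      exact (smul_ne_zero hi hvi) hrm
    have hrpos : 0 < r := lt_of_le_of_ne hr hr0.symm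
    have hm : (m : V) = (a i / r / t i) • (l i : V) := by
      rw [hl, smul_smul, div_mul_cancel₀ _ (ht i).ne', div_eq_inv_mul, mul_smul, hrm,
        inv_smul_smul₀ hr0]
    set s := a i / r / t i with hs
    have hspos : 0 < s := by have := ht i; positivity
    -- Otherwise `m - ⌊s⌋₊ • l i` would be a lattice point on the ray strictly closer to the apex
    -- than `l i`.
    have hfloor : (m : V) = (⌊s⌋₊ : ℝ) • (l i : V) := by
      by_contra hne
      have hfr : 0 < s - ⌊s⌋₊ := by
        refine lt_of_le_of_ne (sub_nonneg.2 (Nat.floor_le hspos.le)) fun h0 => hne ?_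
        rw [hm, ← sub_eq_zero.1 h0.symm]
      have hlt : s - ⌊s⌋₊ < 1 := by linarith [Nat.lt_floor_add_one s]
      have := hmin i (m - ⌊s⌋₊ • l i) ((s - ⌊s⌋₊) * t i) (mul_pos hfr (ht i)) (by
        rw [mul_smul, ← hl]
        push_cast
        rw [hm, sub_smul, Nat.cast_smul_eq_nsmul])
      nlinarith [ht i]
    have hmm : m = ⌊s⌋₊ • l i := by
      ext
      rw [hfloor]
      push_cast
      rw [Nat.cast_smul_eq_nsmul]
    have hone := hprim _ _ hmm
    exact ⟨i, by rw [hmm, hone, one_smul]⟩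
  · rintro ⟨i, rfl⟩
    have hne : (l i : V) ≠ 0 := hli.ne_zero i
    refine ⟨fun h => hne (by simp [h]), hcone ▸ mem_coneOver (fun i => (l i : V)) i, ?_, ?_⟩
    · rw [← hcone]
      rintro _ ⟨a, ha, rfl⟩ _ ⟨b, hb, rfl⟩ hab
      have hsum : ∑ j, (a j + b j) • (l j : V) = ∑ j, (Pi.single i 1 : ι → ℝ) j • (l j : V) := by
        simp only [add_smul, Finset.sum_add_distrib, hab]
        simp [Pi.single_apply]
      have hcoef := Fintype.linearIndependent_iffₛ.1 hli _ _ hsum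
      refine ⟨a i, ha i, Finset.sum_eq_single i (fun j _ hj => ?_) (by simp)⟩
      have := hcoef j
      rw [Pi.single_eq_of_ne hj] at this
      rw [le_antisymm (by linarith [hb j]) (ha j), zero_smul]
    · intro k m hk
      have hk0 : k ≠ 0 := by
        rintro rfl
        exact hne (by simp [hk])
      have hkpos : (0 : ℝ) < k := by positivity
      have hm : (m : V) = (t i / k) • v i := by
        rw [div_eq_inv_mul, mul_smul, ← hl, hk]
        push_cast
        rw [← Nat.cast_smul_eq_nsmul ℝ, inv_smul_smul₀ hkpos.ne']
      have hle := hmin i m _ (div_pos (ht i) hkpos) hm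
      rw [le_div_iff₀ hkpos] at hle
      have hk1 : (k : ℝ) ≤ 1 := by
        by_contra! hgt
        nlinarith [ht i]
      have : k ≤ 1 := by exact_mod_cast hk1
      omega

-- The denominator is `∏ (1 - e(l i))`: it turns the indicator of the cone into that of the
-- half-open parallelepiped.
open scoped Classical in
theorem represents_charFun_coneOver {ι : Type*} [Fintype ι] {l : ι → M}
    (hli : LinearIndependent ℝ (fun i => (l i : V)))
    (hl : primitiveGenerators M (coneOver fun i => (l i : V)) = Set.range l) :
    Represents (fun m : M => if (m : V) ∈ coneOver (fun i => (l i : V)) then (1 : ℂ) else 0)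
      (charFun M (coneOver fun i => (l i : V))) := by
  have hinj : Function.Injective l := Function.Injective.of_comp (f := Subtype.val) hli.injective
  have hl0 : ∀ i, l i ≠ 0 := fun i h => hli.ne_zero i (by simp [h])
  have hfin := finite_lattice_of_isBounded M (isBounded_unitParallelepiped hinj hl)
  have hD : ∀ i, (1 - single (l i) 1 : ℂ[M]) ≠ 0 := fun i => one_sub_single_ne_zero (hl0 i)
  refine ⟨∏ i, (1 - single (l i) 1), ∑ c ∈ hfin.toFinset, single c 1,
    Finset.prod_ne_zero_iff.2 fun i _ => hD i, ?_, ?_⟩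
  · ext m
    rw [shift_prod_one_sub_single, sum_signed_coneOver hli hl]
    simp [Finsupp.single_apply]
  · unfold charFun
    rw [hl, finprod_mem_range hinj, finprod_eq_prod_of_fintype,
      finsum_mem_eq_finite_toFinset_sum _ hfin, map_sum, map_prod, mul_left_comm,
      ← Finset.prod_mul_distrib]
    rw [Finset.prod_eq_one, mul_one]
    · rfl
    · intro i _
      have : algebraMap ℂ[M] (RationalFunctions M) (1 - single (l i) 1) = 1 - e (l i) := by
        rw [map_sub, map_one]; rfl
      rw [this]
      refine mul_inv_cancel₀ ?_
      rw [← this]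
      exact (map_ne_zero_iff _ (IsFractionRing.injective ℂ[M] (FractionRing ℂ[M]))).2 (hD i)

end Lattice

/-! ### From the Gram relation to Brion's formula -/

section Polytope

variable {V : Type*} [NormedAddCommGroup V] [NormedSpace ℝ V]

theorem IsConvexPolytope.convex {P : Set V} (hP : IsConvexPolytope P) : Convex ℝ P := by
  obtain ⟨-, H, -, rfl⟩ := hP
  intro x hx y hy a b ha hb hab h hh
  rw [map_add, map_smul, map_smul, smul_eq_mul, smul_eq_mul]
  calc a * h.1 x + b * h.1 y ≤ a * h.2 + b * h.2 :=
        add_le_add (mul_le_mul_of_nonneg_left (hx h hh) ha) (mul_le_mul_of_nonneg_left (hy h hh) hb)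
    _ = h.2 := by rw [← add_mul, hab, one_mul]

variable [FiniteDimensional ℝ V]

theorem IsConvexPolytope.isCompact {P : Set V} (hP : IsConvexPolytope P) : IsCompact P := by
  have : ProperSpace V := FiniteDimensional.proper ℝ V
  obtain ⟨hb, H, -, rfl⟩ := hP
  refine Metric.isCompact_of_isClosed_isBounded ?_ hb
  have : {x | ∀ h ∈ H, h.1 x ≤ h.2} = ⋂ h ∈ H, {x | h.1 x ≤ h.2} := by
    ext x; simp
  rw [this]
  exact isClosed_biInter fun h _ =>
    isClosed_le (LinearMap.continuous_of_finiteDimensional h.1) continuous_const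

/-- Krein–Milman; no closure is needed because the hull of a finite set is compact. -/
theorem IsConvexPolytope.eq_partialHull {ι : Type*} [Fintype ι] {P : Set V}
    (hP : IsConvexPolytope P) {p : ι → V} (hp : Set.range p = P.extremePoints ℝ) :
    P = partialHull p ∅ := by
  rw [partialHull_empty, ← ((Set.finite_range p).isCompact_convexHull (𝕜 := ℝ)).isClosed.closure_eq, hp,
    closure_convexHull_extremePoints hP.isCompact hP.convex]

variable {M : Submodule ℤ V} [DiscreteTopology M]

open scoped Classical in
theorem represents_charPoly {B : Set V} (hB : Bornology.IsBounded B) :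
    Represents (fun m : M => if (m : V) ∈ B then (1 : ℂ) else 0)
      (algebraMap ℂ[M] (RationalFunctions M) (charPoly {m : M | (m : V) ∈ B})) := by
  have hfin := finite_lattice_of_isBounded M hB
  have : (fun m : M => if (m : V) ∈ B then (1 : ℂ) else 0) =
      ⇑(charPoly {m : M | (m : V) ∈ B}).coeff := by
    ext m
    rw [charPoly, finsum_mem_eq_finite_toFinset_sum _ hfin]
    simp [Finsupp.single_apply]
  rw [this]
  exact represents_coeff _

-- The lattice generators `q` put a lattice point on each extremal ray, as the existence of
-- primitive generators requires.
open scoped Classical in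
theorem represents_charFun {κ : Type*} [Fintype κ] {C : Set V} (hC : IsSimplicialCone C)
    (q : κ → M) (hq : C = coneOver fun k => (q k : V)) :
    Represents (fun m : M => if (m : V) ∈ C then (1 : ℂ) else 0) (charFun M C) := by
  obtain ⟨s, hs, hCs⟩ := hC.exists_eq_coneOver
  obtain ⟨l, hli, hcone, hl⟩ := exists_primitiveGenerators (M := M) hs fun i => by
    obtain ⟨k, t, ht, hk⟩ := exists_mem_ray hs (hCs.symm.trans hq) i
    exact ⟨q k, t, ht, hk⟩
  rw [hCs, ← hcone]
  rw [← hcone] at hl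
  exact represents_charFun_coneOver hli hl

open scoped Classical in
theorem represents_partialHull {ι : Type*} [Fintype ι] {p : ι → M} (hp : Function.Injective p)
    (hsimple : ∀ i, IsSimplicialCone (tangentCone (partialHull (fun i => (p i : V)) ∅) (p i : V)))
    (hb : Bornology.IsBounded (partialHull (fun i => (p i : V)) ∅)) (J : Finset ι) :
    Represents (fun m : M => if (m : V) ∈ partialHull (fun i => (p i : V)) J then (1 : ℂ) else 0)
      ((if J = ∅ then algebraMap ℂ[M] (RationalFunctions M)
          (charPoly {m : M | (m : V) ∈ partialHull (fun i => (p i : V)) ∅}) else 0) +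
        ∑ i, if J = {i} then charFunTranslate M (p i)
          (tangentCone (partialHull (fun i => (p i : V)) ∅) (p i : V)) else 0) := by
  rcases J.eq_empty_or_nonempty with rfl | hne
  · have : ∀ i : ι, ∅ ≠ ({i} : Finset ι) := fun i => (Finset.singleton_ne_empty i).symm
    simpa [this] using represents_charPoly hb
  rw [if_neg hne.ne_empty, zero_add]
  rcases (Finset.one_le_card.2 hne).eq_or_lt with h1 | h1
  · obtain ⟨i, rfl⟩ := Finset.card_eq_one.1 h1.symm
    have hsum : ∀ ν : ι → RationalFunctions M,
        ∑ j, (if ({i} : Finset ι) = {j} then ν j else 0) = ν i := fun ν => by simp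
    rw [hsum]
    have := (represents_charFun (hsimple i) (fun k => p k - p i) (by
      rw [tangentCone_partialHull_empty (fun i => (p i : V)) i]
      rfl)).translate (p i)
    simp only [mem_partialHull_singleton_iff (fun i => (p i : V))]
    exact this
  · obtain ⟨i, hi, j, hj, hij⟩ := Finset.one_lt_card.1 h1
    rw [Finset.sum_eq_zero fun k _ => if_neg fun h => by rw [h] at h1; simp at h1]
    refine represents_zero_of_invariant (sub_ne_zero.2 fun h => hij (hp h)) (k := p i - p j)
      fun m => ?_
    congr 1
    refine propext ⟨fun h => ?_, fun h => ?_⟩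
    · have := partialHull_add_sub_mem (fun i => (p i : V)) hi hj h
      simpa using this
    · have := partialHull_add_sub_mem (fun i => (p i : V)) hj hi h
      convert this using 1
      push_cast
      abel

/-- Brion's formula for the convex hull of the lattice points `p i`. -/
theorem charPoly_partialHull {ι : Type*} [Fintype ι] {p : ι → M} (hp : Function.Injective p)
    (hsimple : ∀ i, IsSimplicialCone (tangentCone (partialHull (fun i => (p i : V)) ∅) (p i : V)))
    (hb : Bornology.IsBounded (partialHull (fun i => (p i : V)) ∅)) :
    algebraMap ℂ[M] (RationalFunctions M)
        (charPoly {m : M | (m : V) ∈ partialHull (fun i => (p i : V)) ∅}) =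
      ∑ i, charFunTranslate M (p i)
        (tangentCone (partialHull (fun i => (p i : V)) ∅) (p i : V)) := by
  classical
  have h := Represents.sum Finset.univ fun J _ =>
    (represents_partialHull hp hsimple hb J).smul ((-1) ^ J.card)
  have h0 : ∑ J : Finset ι, ((-1 : ℤ) ^ J.card) •
      (fun m : M => if (m : V) ∈ partialHull (fun i => (p i : V)) J then (1 : ℂ) else 0) = 0 := by
    ext m
    have := congrArg (Int.cast : ℤ → ℂ)
      (sum_signed_partialHull_eq_zero (fun i => (p i : V)) (m : V))
    push_cast at this
    simpa [Finset.sum_apply] using this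
  rw [h0] at h
  have hzero : Represents (0 : M → ℂ) 0 := by simpa using represents_coeff (0 : ℂ[M])
  -- The represented function is 0, so the signed sum of rational functions vanishes: sign `+` for
  -- `∅`, `-` for each singleton.
  have key := h.unique hzero
  simp only [smul_add, Finset.sum_add_distrib, Finset.smul_sum, smul_ite, smul_zero] at key
  rw [Finset.sum_comm] at key
  simp only [Finset.sum_ite_eq', Finset.mem_univ, if_true, Finset.card_empty, pow_zero, one_smul,
    Finset.card_singleton, pow_one, neg_smul, Finset.sum_neg_distrib] at key
  exact add_neg_eq_zero.1 key

end Polytope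

end Brion

end

theorem mainTheorem2 {V : Type*} [NormedAddCommGroup V] [NormedSpace ℝ V]
    [FiniteDimensional ℝ V] (M : Submodule ℤ V) [DiscreteTopology M] [IsZLattice ℝ M]
    (P : Set V) (hP : Brion.IsSimpleLatticePolytope M P) :
    algebraMap (AddMonoidAlgebra ℂ M) (Brion.RationalFunctions M)
        (Brion.charPoly {m : M | (m : V) ∈ P}) =
      ∑ᶠ α ∈ {α : M | (α : V) ∈ P.extremePoints ℝ},
        Brion.charFunTranslate M α (Brion.tangentCone P (α : V)) := by
  have hfin : {α : M | (α : V) ∈ P.extremePoints ℝ}.Finite :=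
    Brion.finite_lattice_of_isBounded M (hP.isConvexPolytope.1.subset extremePoints_subset)
  let p : hfin.toFinset → M := Subtype.val
  have hrange : Set.range (fun i => (p i : V)) = P.extremePoints ℝ := by
    ext x
    constructor
    · rintro ⟨i, rfl⟩
      exact hfin.mem_toFinset.1 i.2
    · exact fun hx =>
        ⟨⟨⟨x, hP.extremePoints_subset hx⟩, hfin.mem_toFinset.2 hx⟩, rfl⟩
  have hPp := hP.isConvexPolytope.eq_partialHull hrange
  have key := Brion.charPoly_partialHull (p := p) Subtype.val_injective
    (fun i => hPp ▸ hP.simple _ (hrange ▸ Set.mem_range_self i)) (hPp ▸ hP.isConvexPolytope.1)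
  rw [← hPp] at key
  rw [key, finsum_mem_eq_finite_toFinset_sum _ hfin]
  exact Finset.sum_coe_sort hfin.toFinset
    (fun α => Brion.charFunTranslate M α (Brion.tangentCone P (α : V)))
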